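/- Let $\mathbb K=\mathbb R$ or $\mathbb C$, let $f=(f_1,\dots,f_n):\mathbb K^n\to\mathbb K^n$ be a polynomial map with $f_i(0)\neq 0$ for all $i$, and write $f_i=\sum_a c^{(i)}_a x^a$. **Tuples.** Let $N(f_i)\subset\mathbb R^n$ be the Newton polytope of $f_i$ (the convex hull of the exponents of $f_i$). A *minimized tuple* is a tuple $\gamma=(\gamma_1,\dots,\gamma_n)$ for which there is $\alpha\in\mathbb Q^n$ such that, for every $i$, $\gamma_i$ is the face of $N(f_i)$ on which $\langle\cdot,\alpha\rangle$ is minimal. It is an *$m$-tuple* if $\dim(\gamma_1+\dots+\gamma_n)=m$. Write $\delta\preceq\gamma$ if $\delta_i\subset\gamma_i$ for all $i$. Let $\theta(\gamma)$ be the set of those $i$ for which $\gamma_i$ is an *origin face*, i.e. has $0$ as a vertex, and let $\theta(\gamma)^c=\{1,\dots,n\}\setminus\theta(\gamma)$; $\gamma$ is *semi-origin* if $\theta(\gamma)\ne\emptyset$. **Chain transformations.** A *chain transformation* consists of a flag $\gamma^0\preceq\dots\preceq\gamma^{n-1}\preceq\gamma^n=(N(f_1),\dots,N(f_n))$ of minimized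 tuples, $\gamma^j$ being a $j$-tuple (so $\gamma^0_i=\{v_i\}$ with $v_i\in\mathbb Z^n$), and of a matrix $U\in GL_n(\mathbb Z)$ taking to the canonical basis some vectors $\tilde e_1,\dots,\tilde e_n\in\mathbb Z^n$ such that for every $j$: (i) $\sum_i\gamma^j_i-\sum_i v_i$ lies in the cone generated by $\tilde e_1,\dots,\tilde e_j$; (ii) $\tilde e_1,\dots,\tilde e_j$ is a $\mathbb Z$-basis of the lattice of integer points of the linear space parallel to $\sum_i\gamma^j_i$. It is a *$\gamma$-chain transformation* if $\gamma$ is one of the $\gamma^j$ and, for every $i$, $v_i=0$ if and only if $i\in\theta(\gamma)$. Put $$g_i(z)=\sum_{a} c^{(i)}_a z^{U(a-v_i)},\qquad F_{i,\gamma}(z)=\sum_{a\in\gamma_i} c^{(i)}_a z^{U(a-v_i)};$$ these are polynomials in $z_1,\dots,z_n$, and only $z_1,\dots,z_m$ occur in $F_{i,\gamma}$ if $\gamma$ is an $m$-tuple of the flag. **The sets $\mathcal X_\gamma(f)$.** Let $T_m=(\mathbb K\setminus\{0\})^m$. For a minimized semi-origin $m$-tuple $\gamma$ and a $\gamma$-chain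 transformation, $$\mathcal X_\gamma(f)=\{y\in\mathbb K^n : \exists z\in T_m,\ F_{i,\gamma}(z)=y_i\ \text{for } i\in\theta(\gamma),\ F_{i,\gamma}(z)=0\ \text{for } i\in\theta(\gamma)^c\}.$$ **Genericity.** $f$ is *$T$-BG* if its Jacobian determinant is not identically zero and, for every minimized $m$-tuple $\gamma$ with $1\le m\le n-1$, every $\gamma$-chain transformation and every $I\subset\{1,\dots,n\}$, the Jacobian matrix $(\partial g_i/\partial z_k)_{i\in I,\,k\le m}$ has full rank $\min(|I|,m)$ at every solution $z\in T_m\times\{0\}^{n-m}$ of the system $g_i=0$, $i\in I$. It is *very $T$-BG* if, moreover, $\mathcal X_\gamma(f)=\emptyset$ (for every $\gamma$-chain transformation) whenever $\gamma$ is a minimized semi-origin $m$-tuple with $m+1\le|\theta(\gamma)^c|$. **Proposition.** Assume that $f$ is very $T$-BG. Let $\gamma$ be a minimized semi-origin $m$-tuple with $m\le n-2$, and let $\gamma'$ be any minimized $(m+1)$-tuple with $\gamma\preceq\gamma'$. Then, for every choice of the $\gamma$- and $\gamma'$-chain transformations used to define the two sets, $\mathcal X_\gamma(f)$ is empty or contained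 in the (Euclidean) closure of $\mathcal X_{\gamma'}(f)$. -/

import Mathlib

namespace TBG

noncomputable section

open MvPolynomial

/-! ### Newton tuples and minimized tuples -/

/-- An integer vector, viewed in `ℝⁿ`. -/
def realVec {n : ℕ} (a : Fin n → ℤ) : Fin n → ℝ := fun k => (a k : ℝ)

/-- An exponent vector in `ℕⁿ`, viewed in `ℤⁿ`. -/
def intVec {n : ℕ} (a : Fin n →₀ ℕ) : Fin n → ℤ := fun k => (a k : ℤ)

/-- The Newton polytope of `P`: the convex hull in `ℝⁿ` of the support of `P`. -/
def newtonPolytope {K : Type*} [RCLike K] {n : ℕ} (P : MvPolynomial (Fin n) K) :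
    Set (Fin n → ℝ) :=
  convexHull ℝ ((fun a => realVec (intVec a)) '' (P.support : Set (Fin n →₀ ℕ)))

/-- The face of `A` on which the linear function `⟨·, α⟩` reaches its minimum on `A`. -/
def minFace {n : ℕ} (A : Set (Fin n → ℝ)) (α : Fin n → ℚ) : Set (Fin n → ℝ) :=
  {a | a ∈ A ∧ ∀ b ∈ A, ∑ k, a k * (α k : ℝ) ≤ ∑ k, b k * (α k : ℝ)}

/-- `γ` is a minimized tuple of the Newton tuple of `f`: some `α ∈ ℚⁿ` minimizes, simultaneously
for all `i`, the face `γ i` of the Newton polytope of `f i`. -/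
def IsMinimized {K : Type*} [RCLike K] {n : ℕ} (f : Fin n → MvPolynomial (Fin n) K)
    (γ : Fin n → Set (Fin n → ℝ)) : Prop :=
  ∃ α : Fin n → ℚ, ∀ i, γ i = minFace (newtonPolytope (f i)) α

/-- The relation `δ ⪯ γ`: `δ` is a sub-tuple of `γ`. -/
def IsSubTuple {n : ℕ} (δ γ : Fin n → Set (Fin n → ℝ)) : Prop :=
  ∀ i, δ i ⊆ γ i

/-- The Minkowski sum `γ₁ + ⋯ + γₙ`. -/
def minkowskiSum {n : ℕ} (γ : Fin n → Set (Fin n → ℝ)) : Set (Fin n → ℝ) :=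
  {s | ∃ p : Fin n → (Fin n → ℝ), (∀ i, p i ∈ γ i) ∧ s = ∑ i, p i}

/-- The tuple dimension: the dimension of (the affine span of) the Minkowski sum.
An `m`-tuple is a tuple of tuple dimension `m`. -/
def tupleDim {n : ℕ} (γ : Fin n → Set (Fin n → ℝ)) : ℕ :=
  Module.finrank ℝ (vectorSpan ℝ (minkowskiSum γ))

/-- A face is an origin face if the origin is one of its vertices. -/
def IsOriginFace {n : ℕ} (A : Set (Fin n → ℝ)) : Prop :=
  (0 : Fin n → ℝ) ∈ A.extremePoints ℝ

/-- A (minimized) tuple is semi-origin if one of its members is an origin face. -/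
def IsSemiOrigin {n : ℕ} (γ : Fin n → Set (Fin n → ℝ)) : Prop :=
  ∃ i, IsOriginFace (γ i)

/-- The origin-certification set `θ` of `γ`. -/
def originSet {n : ℕ} (γ : Fin n → Set (Fin n → ℝ)) : Set (Fin n) :=
  {i | IsOriginFace (γ i)}

/-! ### Chain transformations -/

/-- A flag `γ⁰ ⪯ ⋯ ⪯ γⁿ` of minimized tuples, `γʲ` a `j`-tuple and `γⁿ` the whole Newton tuple,
with a base-change matrix `U` constructed from that flag: `U` takes a basis `ẽ₁, …, ẽₙ` with the
properties below to the canonical basis. -/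
structure ChainTransformation {K : Type*} [RCLike K] {n : ℕ}
    (f : Fin n → MvPolynomial (Fin n) K) where
  /-- the flag of tuples (equivalently, of the cones minimizing them) -/
  flag : Fin (n + 1) → Fin n → Set (Fin n → ℝ)
  flag_minimized : ∀ j, IsMinimized f (flag j)
  flag_mono : ∀ j k, j ≤ k → IsSubTuple (flag j) (flag k)
  flag_dim : ∀ j, tupleDim (flag j) = (j : ℕ)
  flag_last : ∀ i, flag (Fin.last n) i = newtonPolytope (f i)
  /-- the integer points of which the members of the `0`-tuple `γ⁰` consist -/
  vertex : Fin n → Fin n → ℤ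
  flag_zero : ∀ i, flag 0 i = {realVec (vertex i)}
  /-- the new basis, with integer entries -/
  e : Fin n → Fin n → ℤ
  /-- the Minkowski sum of `γʲ`, translated by minus that of `γ⁰`, lies in the cone spanned by the
  first `j` basis vectors -/
  mem_cone : ∀ j : Fin (n + 1), ∀ p ∈ minkowskiSum (flag j), ∃ c : Fin n → ℝ,
    (∀ k, 0 ≤ c k) ∧ (∀ k : Fin n, (j : ℕ) ≤ (k : ℕ) → c k = 0) ∧
      p - ∑ i, realVec (vertex i) = ∑ k, c k • realVec (e k)
  /-- the first `j` basis vectors span the lattice of integer points in the `j`-dimensional linear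
  space directing the Minkowski sum of `γʲ` -/
  span_lattice : ∀ j : Fin (n + 1), ∀ w : Fin n → ℤ,
    w ∈ Submodule.span ℤ (e '' {k : Fin n | (k : ℕ) < (j : ℕ)}) ↔
      realVec w ∈ vectorSpan ℝ (minkowskiSum (flag j))
  /-- the base-change matrix -/
  U : Matrix (Fin n) (Fin n) ℤ
  U_e : ∀ k, U.mulVec (e k) = Pi.single k 1

/-- `T` is a chain transformation for `γ`: `γ` appears in the flag, and the `i`-th member of `γ⁰` is
the origin exactly when `γ i` is an origin face (that is, the constant term of the `i`-th
transformed polynomial of `f - y` depends on `y i` if and only if `γ i` is an origin face). -/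
def ChainTransformation.IsFor {K : Type*} [RCLike K] {n : ℕ}
    {f : Fin n → MvPolynomial (Fin n) K} (T : ChainTransformation f)
    (γ : Fin n → Set (Fin n → ℝ)) : Prop :=
  (∃ j : Fin (n + 1), T.flag j = γ) ∧ ∀ i, T.vertex i = 0 ↔ IsOriginFace (γ i)

/-- The polynomial obtained from the Laurent polynomial `x⁻ᵛ P(x)` by the change of variables taking
`xᵃ` to `z^(U a)`. For the polynomials and vertices of a chain transformation, all the exponents
`U (a - v)` are nonnegative, so that `Int.toNat` does not change them. -/
def transformPoly {K : Type*} [RCLike K] {n : ℕ} (U : Matrix (Fin n) (Fin n) ℤ) (v : Fin n → ℤ)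
    (P : MvPolynomial (Fin n) K) : MvPolynomial (Fin n) K :=
  ∑ a ∈ P.support,
    monomial (Finsupp.equivFunOnFinite.symm fun k => (U.mulVec (intVec a - v) k).toNat) (P.coeff a)

open Classical in
/-- The part of `P` whose exponent vectors belong to `A`. -/
def restrictPoly {K : Type*} [RCLike K] {n : ℕ} (P : MvPolynomial (Fin n) K)
    (A : Set (Fin n → ℝ)) : MvPolynomial (Fin n) K :=
  ∑ a ∈ P.support.filter (fun a => realVec (intVec a) ∈ A), monomial a (P.coeff a)

/-- The transformed polynomial of `f i`. -/
def ChainTransformation.g {K : Type*} [RCLike K] {n : ℕ}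
    {f : Fin n → MvPolynomial (Fin n) K} (T : ChainTransformation f) (i : Fin n) :
    MvPolynomial (Fin n) K :=
  transformPoly T.U (T.vertex i) (f i)

/-- The transformed polynomial of the restriction of `f i` to `γ i`. If `γ` is an `m`-tuple of the
flag, only the variables `z₁, …, zₘ` occur in it. -/
def ChainTransformation.F {K : Type*} [RCLike K] {n : ℕ}
    {f : Fin n → MvPolynomial (Fin n) K} (T : ChainTransformation f)
    (γ : Fin n → Set (Fin n → ℝ)) (i : Fin n) : MvPolynomial (Fin n) K :=
  transformPoly T.U (T.vertex i) (restrictPoly (f i) (γ i))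

/-- The set `Tₘ × {0}ⁿ⁻ᵐ ⊆ Kⁿ`, with `Tₘ = (K \ {0})ᵐ`. -/
def torusStratum (K : Type*) [RCLike K] (n m : ℕ) : Set (Fin n → K) :=
  {z | ∀ k : Fin n, z k ≠ 0 ↔ (k : ℕ) < m}

/-! ### `T`-BG maps, the sets `X_γ(f)`, very `T`-BG maps -/

/-- `f` is non-degenerate: its Jacobian determinant is not the zero polynomial, that is, its Jacobian
matrix has full rank at generic points. -/
def IsNonDegenerate {K : Type*} [RCLike K] {n : ℕ} (f : Fin n → MvPolynomial (Fin n) K) : Prop :=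
  (Matrix.of fun i j => pderiv j (f i)).det ≠ 0

/-- The Jacobian matrix at `z` of the transformed polynomials `g i`, `i ∈ I`, with respect to the
local coordinates `z₁, …, zₘ` of `Tₘ × {0}ⁿ⁻ᵐ`. -/
def ChainTransformation.jacobian {K : Type*} [RCLike K] {n : ℕ}
    {f : Fin n → MvPolynomial (Fin n) K} (T : ChainTransformation f) (m : ℕ) (I : Finset (Fin n))
    (z : Fin n → K) : Matrix I {k : Fin n // (k : ℕ) < m} K :=
  Matrix.of fun i k => eval z (pderiv (k : Fin n) (T.g i))

/-- `f` is `γ`-generic, for an `m`-tuple `γ` with `m < n`: for all `I ⊆ {1, …, n}`, at every solution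
in `Tₘ × {0}ⁿ⁻ᵐ` of the transformed system `g i = 0`, `i ∈ I`, the Jacobian matrix has full rank. -/
def IsGenericAt {K : Type*} [RCLike K] {n : ℕ} (f : Fin n → MvPolynomial (Fin n) K)
    (γ : Fin n → Set (Fin n → ℝ)) : Prop :=
  ∀ T : ChainTransformation f, T.IsFor γ → ∀ I : Finset (Fin n),
    ∀ z ∈ torusStratum K n (tupleDim γ), (∀ i ∈ I, eval z (T.g i) = 0) →
      (T.jacobian (tupleDim γ) I z).rank = min I.card (tupleDim γ)

/-- `T`-boundary generic maps. -/
def IsTBG {K : Type*} [RCLike K] {n : ℕ} (f : Fin n → MvPolynomial (Fin n) K) : Prop :=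
  IsNonDegenerate f ∧
    ∀ γ : Fin n → Set (Fin n → ℝ), IsMinimized f γ → 1 ≤ tupleDim γ → tupleDim γ < n →
      IsGenericAt f γ

/-- The set `V = {z ∈ Tₘ | F_{i,γ}(z) = 0 for i ∉ θ}`, for an `m`-tuple `γ`; here `Tₘ` is identified
with `Tₘ × {0}ⁿ⁻ᵐ`. If `γ` is an origin tuple, this is all of `Tₘ`. -/
def ChainTransformation.V {K : Type*} [RCLike K] {n : ℕ}
    {f : Fin n → MvPolynomial (Fin n) K} (T : ChainTransformation f)
    (γ : Fin n → Set (Fin n → ℝ)) : Set (Fin n → K) :=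
  {z | z ∈ torusStratum K n (tupleDim γ) ∧ ∀ i ∉ originSet γ, eval z (T.F γ i) = 0}

/-- The set `X_γ(f)`: the preimage of `F_{θ,γ}(V)` under the projection `y ↦ (y i)_{i ∈ θ}`.
This is the `γ`-parametrized set `F_γ(Tₘ)` if `γ` is an origin tuple (then `θ = {1, …, n}`), and the
`γ`-lifted set if `γ` is strictly semi-origin. -/
def ChainTransformation.X {K : Type*} [RCLike K] {n : ℕ}
    {f : Fin n → MvPolynomial (Fin n) K} (T : ChainTransformation f)
    (γ : Fin n → Set (Fin n → ℝ)) : Set (Fin n → K) :=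
  {y | ∃ z ∈ T.V γ, ∀ i ∈ originSet γ, y i = eval z (T.F γ i)}

/-- Very `T`-BG maps. -/
def IsVeryTBG {K : Type*} [RCLike K] {n : ℕ} (f : Fin n → MvPolynomial (Fin n) K) : Prop :=
  IsTBG f ∧
    ∀ γ : Fin n → Set (Fin n → ℝ), IsMinimized f γ → IsSemiOrigin γ →
      tupleDim γ + 1 ≤ (originSet γ)ᶜ.ncard →
        ∀ T : ChainTransformation f, T.IsFor γ → T.X γ = ∅

end

end TBG

/-!
The set `X_γ(f)` does not depend on the chain transformation: `y` belongs to it if and only if some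
point `x` of the torus `(K \ {0})ⁿ` satisfies `f_{i,γ}(x) = y i` for `i ∈ θ(γ)` and `f_{i,γ}(x) = 0`
for the other `i`, where `f_{i,γ}` is the part of `f i` on `γ i`; the point `z` of the stratum and
`x` are related by `xᵃ = z ^ (U a)`. Only one half of this is used for `γ'`, namely
`ChainTransformation.exists_stratum_eval_F`, so that no flag has to contain both `γ` and `γ'`.

Let `y ∈ X_γ(f)` come from a point `z` of the stratum of `γ`, and let `w₀` be `z` with its zero
coordinates replaced by `1`. An integer vector `A` minimizing `γ` gives the points `x(w, s)`,
`x_l = w ^ (U e_l) s ^ (A_l)`, of the torus, for `w` near `w₀` and small `s ≠ 0`. Along them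
`x⁻ᵛ f_{i,γ'}(x)`, `v` being the `i`-th vertex, is a polynomial `curvePoly` in `(w, s)` which at
`s = 0` becomes `F i` (`curvePoly_zero`), as `γ i` is the part of `γ' i` minimizing `A`. For
`i ∉ θ(γ)` the condition that `f_{i,γ'}(x)` equals `y i` (if `i ∈ θ(γ')`) or `0` (otherwise) thus
becomes a polynomial equation in `(w, s)` which at `s = 0` is the equation `F i = 0`: the constant
`y i` gets multiplied by `x⁻ᵛ`, a polynomial in `(w, s)` because `0` is in the support of `f i`, and
divisible by `s` because `0 ∉ γ i`.

If `X_γ(f)` is not excluded by the second half of the very `T`-BG condition, at most `m` indices are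
outside `θ(γ)`, and genericity makes the corresponding `F i` submersive at `w₀`
(`exists_hasDerivAt_F`). Hence the map sending `(w, s)` to the left-hand sides of the equations and
to `s` is open at `(w₀, 0)`, and the equations have solutions with `s ≠ 0` arbitrarily close to
`(w₀, 0)` (`frequently_zero_of_surjective`). They give points of `X_γ'(f)` whose coordinates in
`θ(γ)` tend to those of `y`, the others being equal to those of `y`.
-/

namespace TBG

open MvPolynomial Filter Topology

/-! ### Zeros of a map that is submersive in one group of variables -/

/-- If `H (w, s)` vanishes at `(w₀, 0)` and its partial derivative in `w` is onto there, then there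
are zeros `(w, s)` with `s ≠ 0` arbitrarily close to `(w₀, 0)`. -/
theorem frequently_zero_of_surjective {K E F : Type*} [RCLike K]
    [NormedAddCommGroup E] [NormedSpace K E] [CompleteSpace E]
    [NormedAddCommGroup F] [NormedSpace K F] [CompleteSpace F]
    (H : E × K → F) (w₀ : E) (hH : ContDiffAt K 1 H (w₀, 0)) (h0 : H (w₀, 0) = 0)
    (hs : ∀ u : F, ∃ v : E, HasDerivAt (fun t : K => H (w₀ + t • v, 0)) u 0) :
    ∃ᶠ q in 𝓝 (w₀, (0 : K)), H q = 0 ∧ q.2 ≠ 0 := by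
  have hd : HasStrictFDerivAt H (fderiv K H (w₀, 0)) (w₀, 0) := hH.hasStrictFDerivAt one_ne_zero
  set H' := fderiv K H (w₀, 0)
  have hΦ : HasStrictFDerivAt (fun q : E × K => (H q, q.2))
      (H'.prod (ContinuousLinearMap.snd K E K)) (w₀, 0) :=
    hd.prodMk hasStrictFDerivAt_snd
  have hdir : ∀ u : F, ∃ v : E, H' (v, 0) = u := by
    intro u
    obtain ⟨v, hv⟩ := hs u
    refine ⟨v, ?_⟩
    let c : K → E × K := fun t => (w₀ + t • v, 0)
    have h1 : HasDerivAt c (v, 0) 0 := by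
      have h2 : HasDerivAt (fun t : K => w₀ + t • v) v 0 := by
        simpa using ((hasDerivAt_id (0 : K)).smul_const v).const_add w₀
      exact h2.prodMk (hasDerivAt_const _ _)
    have h3 : HasFDerivAt H H' (c 0) := by
      simpa [c] using hd.hasFDerivAt
    exact (h3.comp_hasDerivAt (0 : K) h1).unique hv
  have hsurj : (H'.prod (ContinuousLinearMap.snd K E K)).range = ⊤ := by
    refine LinearMap.range_eq_top.2 ?_
    rintro ⟨u, σ⟩
    obtain ⟨v, hv⟩ := hdir (u - σ • H' (0, 1))
    refine ⟨(v, σ), ?_⟩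
    have : ((v, σ) : E × K) = (v, 0) + σ • (0, 1) := by simp
    have h4 : H' (v, σ) = u := by
      rw [this, map_add, map_smul, hv]; simp
    simp [h4]
  have hmap := hΦ.map_nhds_eq_of_surj hsurj
  -- The points `(0, s)`, `s ≠ 0`, accumulate at `(0, 0)`, and `(w, s) ↦ (H (w, s), s)` is open.
  have hfreq : ∃ᶠ p in 𝓝 ((0 : F), (0 : K)), p.1 = 0 ∧ p.2 ≠ 0 := by
    have hne : ∃ᶠ s in 𝓝 (0 : K), s ≠ 0 := by
      have : (𝓝[≠] (0 : K)).NeBot := inferInstance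
      exact frequently_mem_iff_neBot.2 this
    have ht : Tendsto (fun s : K => ((0 : F), s)) (𝓝 0) (𝓝 ((0 : F), (0 : K))) :=
      (Continuous.prodMk_right (0 : F)).tendsto' _ _ rfl
    exact ht.frequently (hne.mono fun s hs => ⟨rfl, hs⟩)
  simp only [h0] at hmap
  rw [← hmap, frequently_map] at hfreq
  exact hfreq

/-- The directional derivative of a polynomial function. -/
theorem hasDerivAt_eval_add_smul {K : Type*} [RCLike K] {n : ℕ} (P : MvPolynomial (Fin n) K)
    (w v : Fin n → K) :
    HasDerivAt (fun t : K => eval (w + t • v) P) (∑ k, v k * eval w (pderiv k P)) 0 := by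
  induction P using MvPolynomial.induction_on with
  | C a => simpa using hasDerivAt_const (0 : K) a
  | add p q hp hq =>
    simpa [mul_add, Finset.sum_add_distrib] using hp.fun_add hq
  | mul_X p j hp =>
    have hX : HasDerivAt (fun t : K => w j + t * v j) (v j) 0 := by
      simpa using ((hasDerivAt_id (0 : K)).mul_const (v j)).const_add (w j)
    have := hp.fun_mul hX
    simp only [zero_smul, add_zero, zero_mul] at this
    have hder : ∑ k, v k * eval w (pderiv k (p * X j)) =
        (∑ k, v k * eval w (pderiv k p)) * w j + eval w p * v j := by
      simp only [Derivation.leibniz, map_add, smul_eq_mul, map_mul, eval_X, pderiv_X, mul_add,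
        Finset.sum_add_distrib, Finset.sum_mul]
      rw [add_comm]
      congr 1
      · exact Finset.sum_congr rfl fun k _ => by ring
      · rw [Finset.sum_eq_single j]
        · simp [mul_comm]
        · intro k _ hk
          simp [hk.symm]
        · simp
    rw [hder]
    simpa only [map_mul, eval_X, Pi.add_apply, Pi.smul_apply, smul_eq_mul] using this

/-- A matrix whose rank is its number of rows defines a surjective map. -/
theorem mulVec_surjective_of_rank_eq {K : Type*} [Field K] {ι κ : Type*} [Fintype ι] [Fintype κ]
    (J : Matrix ι κ K) (h : J.rank = Fintype.card ι) : Function.Surjective J.mulVec := by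
  have : LinearMap.range J.mulVecLin = ⊤ := by
    apply Submodule.eq_top_of_finrank_eq
    simpa [Matrix.rank] using h
  exact LinearMap.range_eq_top.1 this

/-! ### Laurent monomials -/

/-- The value at `w` of the Laurent monomial with exponent vector `b`. -/
noncomputable def laurent {K : Type*} [Field K] {n : ℕ} (w : Fin n → K) (b : Fin n → ℤ) : K :=
  ∏ k, w k ^ b k

theorem laurent_add {K : Type*} [Field K] {n : ℕ} {w : Fin n → K} (hw : ∀ k, w k ≠ 0)
    (a b : Fin n → ℤ) : laurent w (a + b) = laurent w a * laurent w b := by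
  simp [laurent, zpow_add₀ (hw _), Finset.prod_mul_distrib]

theorem laurent_zero {K : Type*} [Field K] {n : ℕ} (w : Fin n → K) : laurent w 0 = 1 := by
  simp [laurent]

theorem laurent_ne_zero {K : Type*} [Field K] {n : ℕ} {w : Fin n → K} (hw : ∀ k, w k ≠ 0)
    (b : Fin n → ℤ) : laurent w b ≠ 0 :=
  Finset.prod_ne_zero_iff.2 fun k _ => zpow_ne_zero _ (hw k)

theorem laurent_eq_prod_toNat {K : Type*} [Field K] {n : ℕ} (w : Fin n → K) {b : Fin n → ℤ}
    (hb : ∀ k, 0 ≤ b k) : laurent w b = ∏ k, w k ^ (b k).toNat := by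
  refine Finset.prod_congr rfl fun k _ => ?_
  rw [← zpow_natCast, Int.toNat_of_nonneg (hb k)]

theorem zpow_sum {K ι : Type*} [Field K] {x : K} (hx : x ≠ 0) (s : Finset ι) (b : ι → ℤ) :
    x ^ ∑ i ∈ s, b i = ∏ i ∈ s, x ^ b i := by
  classical
  induction s using Finset.induction_on with
  | empty => simp
  | insert i s hi ih => rw [Finset.sum_insert hi, Finset.prod_insert hi, zpow_add₀ hx, ih]

/-- The monomial change of variables `x_l = w ^ (U e_l) s ^ (A_l)`. -/
theorem laurent_monomialCurve {K : Type*} [Field K] {n : ℕ} {w : Fin n → K} (hw : ∀ k, w k ≠ 0)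
    {s : K} (hs : s ≠ 0) (U : Matrix (Fin n) (Fin n) ℤ) (A b : Fin n → ℤ) :
    laurent (fun l => laurent w (fun k => U k l) * s ^ A l) b =
      laurent w (U.mulVec b) * s ^ (A ⬝ᵥ b) := by
  simp only [laurent, Matrix.mulVec, dotProduct, zpow_sum hs, mul_zpow, Finset.prod_mul_distrib,
    zpow_mul]
  congr 1
  simp_rw [zpow_sum (hw _), ← Finset.prod_zpow, zpow_mul]
  exact Finset.prod_comm

/-! ### Exponents along a chain transformation -/

section Structure

variable {K : Type*} [RCLike K] {n : ℕ} {f : Fin n → MvPolynomial (Fin n) K}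

/-- The integer vector `A` cuts out the tuple `γ`: `γ i` is the face of the Newton polytope of `f i`
on which `⟨·, A⟩` is minimal. -/
def IsWeight (f : Fin n → MvPolynomial (Fin n) K) (γ : Fin n → Set (Fin n → ℝ))
    (A : Fin n → ℤ) : Prop :=
  ∀ i p, p ∈ γ i ↔ p ∈ newtonPolytope (f i) ∧
    ∀ b ∈ newtonPolytope (f i), p ⬝ᵥ realVec A ≤ b ⬝ᵥ realVec A

theorem IsMinimized.exists_isWeight {γ : Fin n → Set (Fin n → ℝ)} (hγ : IsMinimized f γ) :
    ∃ A : Fin n → ℤ, IsWeight f γ A := by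
  obtain ⟨α, hα⟩ := hγ
  obtain ⟨⟨N, hN⟩, hA⟩ := IsLocalization.exist_integer_multiples_of_finite
    (Submonoid.pos ℤ) α
  choose A hA using hA
  have hN0 : (0 : ℝ) < N := by exact_mod_cast hN
  have hAk : ∀ k, (A k : ℝ) = N * (α k : ℝ) := by
    intro k
    have := hA k
    simp only [zsmul_eq_mul, algebraMap_int_eq, eq_intCast] at this
    exact_mod_cast this
  have hdot : ∀ p : Fin n → ℝ, p ⬝ᵥ realVec A = N * ∑ k, p k * (α k : ℝ) := by
    intro p
    simp only [dotProduct, realVec, hAk, Finset.mul_sum]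
    exact Finset.sum_congr rfl fun k _ => by ring
  refine ⟨A, fun i p => ?_⟩
  rw [hα i]
  simp only [minFace, Set.mem_ofPred_eq, hdot, mul_le_mul_iff_right₀ hN0]

theorem mem_newtonPolytope {P : MvPolynomial (Fin n) K} {a : Fin n →₀ ℕ} (ha : a ∈ P.support) :
    realVec (intVec a) ∈ newtonPolytope P :=
  subset_convexHull ℝ _ ⟨a, ha, rfl⟩

theorem nonneg_of_mem_newtonPolytope {P : MvPolynomial (Fin n) K} {p : Fin n → ℝ}
    (hp : p ∈ newtonPolytope P) : 0 ≤ p := by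
  refine convexHull_min ?_ (convex_Ici (𝕜 := ℝ) (0 : Fin n → ℝ)) hp
  rintro _ ⟨a, -, rfl⟩ k
  simp [realVec, intVec]

theorem IsMinimized.subset {γ : Fin n → Set (Fin n → ℝ)} (hγ : IsMinimized f γ) (i : Fin n) :
    γ i ⊆ newtonPolytope (f i) := by
  obtain ⟨α, hα⟩ := hγ
  rw [hα i]
  exact fun p hp => hp.1

/-- As the Newton polytopes lie in the nonnegative orthant, a face containing the origin has it as a
vertex. -/
theorem IsMinimized.isOriginFace_iff {γ : Fin n → Set (Fin n → ℝ)} (hγ : IsMinimized f γ)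
    (i : Fin n) : IsOriginFace (γ i) ↔ (0 : Fin n → ℝ) ∈ γ i := by
  refine ⟨fun h => h.1, fun h => ?_⟩
  refine mem_extremePoints.2 ⟨h, ?_⟩
  rintro p hp q hq ⟨s, t, hs, ht, -, hst⟩
  have hp0 := nonneg_of_mem_newtonPolytope (hγ.subset i hp)
  have hq0 := nonneg_of_mem_newtonPolytope (hγ.subset i hq)
  have key : ∀ k, p k = 0 ∧ q k = 0 := by
    intro k
    have h1 : s * p k + t * q k = 0 := by simpa using congrFun hst k
    have h2 : 0 ≤ p k := hp0 k
    have h3 : 0 ≤ q k := hq0 k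
    have h4 := mul_nonneg hs.le h2
    have h5 := mul_nonneg ht.le h3
    constructor
    · exact (mul_eq_zero.1 (by linarith : s * p k = 0)).resolve_left hs.ne'
    · exact (mul_eq_zero.1 (by linarith : t * q k = 0)).resolve_left ht.ne'
  exact ⟨funext fun k => (key k).1, funext fun k => (key k).2⟩

namespace ChainTransformation

variable (T : ChainTransformation f)

theorem vertex_mem (j : Fin (n + 1)) (i : Fin n) : realVec (T.vertex i) ∈ T.flag j i :=
  T.flag_mono 0 j (Fin.zero_le j) i (by rw [T.flag_zero]; rfl)

theorem tupleDim_flag {γ : Fin n → Set (Fin n → ℝ)} {j : Fin (n + 1)} (hj : T.flag j = γ) :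
    tupleDim γ = j := hj ▸ T.flag_dim j

theorem U_mul_e : T.U * (Matrix.of T.e).transpose = 1 := by
  ext k l
  have := congrFun (T.U_e l) k
  simpa [Matrix.mul_apply, Matrix.mulVec, dotProduct, Matrix.one_apply, Pi.single_apply] using this

theorem eq_sum_smul_e (b : Fin n → ℤ) : b = ∑ k, T.U.mulVec b k • T.e k := by
  have h := mul_eq_one_comm.1 T.U_mul_e
  have h2 : (Matrix.of T.e).transpose.mulVec (T.U.mulVec b) = b := by
    rw [Matrix.mulVec_mulVec, h, Matrix.one_mulVec]
  ext l
  rw [← congrFun h2 l]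
  simp [Matrix.mulVec, dotProduct, mul_comm]

/-- Exponents occurring in the `i`-th member of `γʲ`, seen from the vertex `vᵢ`, have nonnegative
new coordinates, the coordinates from the `j`-th on being zero. -/
theorem mulVec_of_mem_flag (j : Fin (n + 1)) (i : Fin n) (a : Fin n → ℤ)
    (ha : realVec a ∈ T.flag j i) :
    (∀ k, 0 ≤ T.U.mulVec (a - T.vertex i) k) ∧
      ∀ k : Fin n, (j : ℕ) ≤ k → T.U.mulVec (a - T.vertex i) k = 0 := by
  classical
  obtain ⟨c, hc0, hcj, hc⟩ := T.mem_cone j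
    (∑ l, Function.update (fun l => realVec (T.vertex l)) i (realVec a) l)
    ⟨_, fun l => by
      rcases eq_or_ne l i with rfl | hl
      · simpa using ha
      · simpa [hl] using T.vertex_mem j l, rfl⟩
  rw [← Finset.sum_sub_distrib, Finset.sum_eq_single i (fun l _ hl => by simp [hl]) (by simp),
    Function.update_self] at hc
  have key : ∀ k, ((T.U.mulVec (a - T.vertex i) k : ℤ) : ℝ) = c k := by
    intro k
    have hUe : ∀ l, ∑ x, (T.U k x : ℝ) * (T.e l x : ℝ) = if k = l then 1 else 0 := by
      intro l
      have := congrFun (T.U_e l) k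
      simp only [Matrix.mulVec, dotProduct, Pi.single_apply] at this
      exact_mod_cast congrArg (Int.cast : ℤ → ℝ) this
    have hx : ∀ x, ((a x : ℝ) - T.vertex i x) = ∑ l, c l * (T.e l x : ℝ) := by
      intro x
      simpa [realVec] using congrFun hc x
    simp only [Matrix.mulVec, dotProduct, Pi.sub_apply]
    push_cast
    simp_rw [hx, Finset.mul_sum]
    rw [Finset.sum_comm]
    simp_rw [mul_left_comm _ (c _), ← Finset.mul_sum, hUe]
    simp
  constructor
  · intro k
    exact_mod_cast (key k).symm ▸ hc0 k
  · intro k hk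
    exact_mod_cast (key k).trans (hcj k hk)

theorem mulVec_nonneg {i : Fin n} {a : Fin n →₀ ℕ} (ha : a ∈ (f i).support) (k : Fin n) :
    0 ≤ T.U.mulVec (intVec a - T.vertex i) k :=
  (T.mulVec_of_mem_flag (Fin.last n) i (intVec a)
    (by rw [T.flag_last]; exact mem_newtonPolytope ha)).1 k

variable {T} {γ : Fin n → Set (Fin n → ℝ)} {A : Fin n → ℤ} {j : Fin (n + 1)}

theorem realVec_dotProduct (a b : Fin n → ℤ) :
    realVec a ⬝ᵥ realVec b = ((b ⬝ᵥ a : ℤ) : ℝ) := by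
  simp [realVec, dotProduct, mul_comm]

theorem weight_nonneg (hA : IsWeight f γ A) (hj : T.flag j = γ) {i : Fin n} {a : Fin n →₀ ℕ}
    (ha : a ∈ (f i).support) : 0 ≤ A ⬝ᵥ (intVec a - T.vertex i) := by
  have h := ((hA i _).1 (hj ▸ T.vertex_mem j i)).2 _ (mem_newtonPolytope ha)
  rw [realVec_dotProduct, realVec_dotProduct] at h
  rw [dotProduct_sub, sub_nonneg]
  exact_mod_cast h

theorem weight_eq_zero_iff (hA : IsWeight f γ A) (hj : T.flag j = γ) {i : Fin n}
    {a : Fin n →₀ ℕ} (ha : a ∈ (f i).support) :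
    A ⬝ᵥ (intVec a - T.vertex i) = 0 ↔ realVec (intVec a) ∈ γ i := by
  have hv := (hA i _).1 (hj ▸ T.vertex_mem j i)
  rw [dotProduct_sub, sub_eq_zero]
  constructor
  · intro h
    refine (hA i _).2 ⟨mem_newtonPolytope ha, fun b hb => ?_⟩
    rw [realVec_dotProduct, h, ← realVec_dotProduct]
    exact hv.2 b hb
  · intro h
    have h1 := ((hA i _).1 h).2 _ hv.1
    have h2 := hv.2 _ (mem_newtonPolytope ha)
    have h3 := le_antisymm h1 h2
    rw [realVec_dotProduct, realVec_dotProduct] at h3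
    exact_mod_cast h3

/-- An exponent of `f i` whose new coordinates vanish from the `j`-th on belongs to `γʲ`: it differs
from the vertex by a vector directing `γʲ`, on which the minimized linear function vanishes. -/
theorem mem_of_mulVec_eq_zero (hA : IsWeight f γ A) (hj : T.flag j = γ) {i : Fin n}
    {a : Fin n →₀ ℕ} (ha : a ∈ (f i).support)
    (h : ∀ k : Fin n, (j : ℕ) ≤ k → T.U.mulVec (intVec a - T.vertex i) k = 0) :
    realVec (intVec a) ∈ γ i := by
  rw [← weight_eq_zero_iff hA hj ha]
  set b := intVec a - T.vertex i
  have hb : b ∈ Submodule.span ℤ (T.e '' {k : Fin n | (k : ℕ) < (j : ℕ)}) := by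
    rw [T.eq_sum_smul_e b]
    refine Submodule.sum_mem _ fun k _ => ?_
    by_cases hk : (k : ℕ) < j
    · exact Submodule.smul_mem _ _ (Submodule.subset_span ⟨k, hk, rfl⟩)
    · rw [h k (not_lt.1 hk), zero_smul]
      exact Submodule.zero_mem _
  rw [T.span_lattice j b, hj] at hb
  let φ : (Fin n → ℝ) →ₗ[ℝ] ℝ :=
    { toFun := fun p => p ⬝ᵥ realVec A
      map_add' := fun p q => add_dotProduct p q _
      map_smul' := fun c p => smul_dotProduct c p _ }
  have hle : vectorSpan ℝ (minkowskiSum γ) ≤ LinearMap.ker φ := by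
    refine Submodule.span_le.2 ?_
    rintro _ ⟨_, ⟨p, hp, rfl⟩, _, ⟨q, hq, rfl⟩, rfl⟩
    have hpq : ∀ i, φ (p i) = φ (q i) := fun i =>
      le_antisymm (((hA i _).1 (hp i)).2 _ ((hA i _).1 (hq i)).1)
        (((hA i _).1 (hq i)).2 _ ((hA i _).1 (hp i)).1)
    simp [LinearMap.mem_ker, hpq]
  have h0 : realVec b ⬝ᵥ realVec A = 0 := hle hb
  rw [realVec_dotProduct] at h0
  exact_mod_cast h0

end ChainTransformation

end Structure

/-! ### Evaluating the transformed polynomials -/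

section Evaluation

variable {K : Type*} [RCLike K] {n : ℕ} {f : Fin n → MvPolynomial (Fin n) K}

theorem eval_monomial_eq_prod (w : Fin n → K) (e : Fin n →₀ ℕ) (c : K) :
    eval w (monomial e c) = c * ∏ k, w k ^ e k := by
  rw [eval_monomial, Finsupp.prod_fintype _ _ (fun _ => pow_zero _)]

open Classical in
/-- The exponent vectors of `P` that lie in `A`. -/
noncomputable def supportIn (P : MvPolynomial (Fin n) K) (A : Set (Fin n → ℝ)) :
    Finset (Fin n →₀ ℕ) :=
  P.support.filter fun a => realVec (intVec a) ∈ A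

theorem mem_supportIn {P : MvPolynomial (Fin n) K} {A : Set (Fin n → ℝ)} {a : Fin n →₀ ℕ} :
    a ∈ supportIn P A ↔ a ∈ P.support ∧ realVec (intVec a) ∈ A := by
  simp only [supportIn, Finset.mem_filter]

theorem coeff_restrictPoly {P : MvPolynomial (Fin n) K} {A : Set (Fin n → ℝ)} {a : Fin n →₀ ℕ}
    (ha : a ∈ supportIn P A) : (restrictPoly P A).coeff a = P.coeff a := by
  classical
  simp only [restrictPoly, coeff_sum, coeff_monomial]
  rw [Finset.sum_ite_eq' _ a]
  exact if_pos ha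

theorem support_restrictPoly (P : MvPolynomial (Fin n) K) (A : Set (Fin n → ℝ)) :
    (restrictPoly P A).support = supportIn P A := by
  classical
  ext a
  constructor
  · intro h
    by_contra h2
    refine mem_support_iff.1 h ?_
    simp only [restrictPoly, coeff_sum, coeff_monomial]
    rw [Finset.sum_ite_eq' _ a]
    exact if_neg h2
  · intro h
    rw [mem_support_iff, coeff_restrictPoly h]
    exact mem_support_iff.1 (mem_supportIn.1 h).1

namespace ChainTransformation

variable (T : ChainTransformation f)

/-- The exponent of the monomial of `T.g i` that comes from the exponent `a` of `f i`. -/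
noncomputable def expo (i : Fin n) (a : Fin n →₀ ℕ) : Fin n →₀ ℕ :=
  Finsupp.equivFunOnFinite.symm fun k => (T.U.mulVec (intVec a - T.vertex i) k).toNat

theorem expo_apply (i : Fin n) (a : Fin n →₀ ℕ) (k : Fin n) :
    T.expo i a k = (T.U.mulVec (intVec a - T.vertex i) k).toNat := rfl

theorem g_eq (i : Fin n) :
    T.g i = ∑ a ∈ (f i).support, monomial (T.expo i a) ((f i).coeff a) := rfl

theorem F_eq (γ : Fin n → Set (Fin n → ℝ)) (i : Fin n) :
    T.F γ i = ∑ a ∈ supportIn (f i) (γ i), monomial (T.expo i a) ((f i).coeff a) := by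
  rw [F, transformPoly, support_restrictPoly]
  exact Finset.sum_congr rfl fun a ha => by rw [coeff_restrictPoly ha]; rfl

variable {T} {γ : Fin n → Set (Fin n → ℝ)} {j : Fin (n + 1)}

theorem expo_eq_zero (hj : T.flag j = γ) {i : Fin n} {a : Fin n →₀ ℕ}
    (ha : a ∈ supportIn (f i) (γ i)) {k : Fin n} (hk : (j : ℕ) ≤ k) : T.expo i a k = 0 := by
  rw [expo_apply, (T.mulVec_of_mem_flag j i _ (hj ▸ (mem_supportIn.1 ha).2)).2 k hk, Int.toNat_zero]

theorem exists_expo_ne_zero (hγ : IsMinimized f γ) (hj : T.flag j = γ) {i : Fin n}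
    {a : Fin n →₀ ℕ} (ha : a ∈ (f i).support) (ha' : a ∉ supportIn (f i) (γ i)) :
    ∃ k : Fin n, (j : ℕ) ≤ k ∧ T.expo i a k ≠ 0 := by
  obtain ⟨A, hA⟩ := hγ.exists_isWeight
  by_contra! h
  refine ha' (mem_supportIn.2 ⟨ha, mem_of_mulVec_eq_zero hA hj ha fun k hk => ?_⟩)
  have h1 := h k hk
  rw [expo_apply, Int.toNat_eq_zero] at h1
  exact le_antisymm h1 (T.mulVec_nonneg ha k)

theorem prod_pow_stratum {m : ℕ} {z w : Fin n → K} (hw : ∀ k : Fin n, (k : ℕ) < m → w k = z k)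
    {e : Fin n → ℕ} (he : ∀ k : Fin n, m ≤ k → e k = 0) : ∏ k, z k ^ e k = ∏ k, w k ^ e k := by
  refine Finset.prod_congr rfl fun k _ => ?_
  rcases lt_or_ge (k : ℕ) m with hk | hk
  · rw [hw k hk]
  · rw [he k hk, pow_zero, pow_zero]

theorem eval_F_stratum (hj : T.flag j = γ) {z w : Fin n → K}
    (hw : ∀ k : Fin n, (k : ℕ) < j → w k = z k) (i : Fin n) :
    eval z (T.F γ i) = eval w (T.F γ i) := by
  simp only [F_eq, map_sum, eval_monomial_eq_prod]
  refine Finset.sum_congr rfl fun a ha => ?_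
  rw [prod_pow_stratum hw fun k hk => expo_eq_zero hj ha hk]

theorem prod_pow_eq_zero {m : ℕ} {z : Fin n → K} (hz : z ∈ torusStratum K n m) {e : Fin n → ℕ}
    {k : Fin n} (hk : m ≤ k) (he : e k ≠ 0) : ∏ k, z k ^ e k = 0 := by
  refine Finset.prod_eq_zero (Finset.mem_univ k) ?_
  have : z k = 0 := not_not.1 fun h => absurd ((hz k).1 h) (not_lt.2 hk)
  rw [this, zero_pow he]

/-- On the stratum of `γ` the polynomial `g i` restricts to `F i`. -/
theorem eval_g_eq_eval_F (hγ : IsMinimized f γ) (hj : T.flag j = γ) {z : Fin n → K}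
    (hz : z ∈ torusStratum K n j) (i : Fin n) : eval z (T.g i) = eval z (T.F γ i) := by
  simp only [g_eq, F_eq, map_sum, eval_monomial_eq_prod]
  refine (Finset.sum_subset (fun a ha => (mem_supportIn.1 ha).1) fun a ha ha' => ?_).symm
  obtain ⟨k, hk, he⟩ := exists_expo_ne_zero hγ hj ha ha'
  rw [prod_pow_eq_zero hz hk he, mul_zero]

/-- Along the stratum of `γ` the derivatives of `g i` in the coordinates of the stratum are those of
`F i`, which depend on these coordinates only. -/
theorem eval_pderiv_g_eq (hγ : IsMinimized f γ) (hj : T.flag j = γ) {z w : Fin n → K}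
    (hz : z ∈ torusStratum K n j) (hw : ∀ k : Fin n, (k : ℕ) < j → w k = z k) (i : Fin n)
    {k : Fin n} (hk : (k : ℕ) < j) :
    eval z (pderiv k (T.g i)) = eval w (pderiv k (T.F γ i)) := by
  simp only [g_eq, F_eq, map_sum, pderiv_monomial, eval_monomial_eq_prod]
  have hne : ∀ l : Fin n, (j : ℕ) ≤ l → ∀ e : Fin n →₀ ℕ,
      (e - Finsupp.single k 1 : Fin n →₀ ℕ) l = e l := by
    intro l hl e
    have : k ≠ l := by rintro rfl; omega
    simp [this]
  rw [← Finset.sum_subset (fun a ha => (mem_supportIn.1 ha).1) fun a ha ha' => ?_]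
  · refine Finset.sum_congr rfl fun a ha => ?_
    rw [prod_pow_stratum hw fun l hl => (hne l hl _).trans (expo_eq_zero hj ha hl)]
  · obtain ⟨l, hl, he⟩ := exists_expo_ne_zero hγ hj ha ha'
    rw [prod_pow_eq_zero hz hl (by rwa [hne l hl]), mul_zero]

/-- Every point `x` of the torus gives a point `z` of the stratum of `γ` at which `F i` takes the
value of `x⁻ᵛ f_{i,γ}(x)`, `v` being the `i`-th vertex. -/
theorem exists_stratum_eval_F (hj : T.flag j = γ) {x : Fin n → K} (hx : ∀ k, x k ≠ 0) :
    ∃ z ∈ torusStratum K n j, ∀ i, eval z (T.F γ i) =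
      ∑ a ∈ supportIn (f i) (γ i), (f i).coeff a * laurent x (intVec a - T.vertex i) := by
  let w : Fin n → K := fun k => laurent x (T.e k)
  refine ⟨fun k => if (k : ℕ) < j then w k else 0, fun k => ?_, fun i => ?_⟩
  · simpa using fun _ => laurent_ne_zero hx _
  rw [eval_F_stratum (w := w) hj (fun k hk => (if_pos hk).symm)]
  simp only [F_eq, map_sum, eval_monomial_eq_prod]
  refine Finset.sum_congr rfl fun a ha => ?_
  congr 1
  conv_rhs => rw [T.eq_sum_smul_e (intVec a - T.vertex i)]
  have h1 : ∀ k, w k ^ T.expo i a k = w k ^ T.U.mulVec (intVec a - T.vertex i) k := by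
    intro k
    rw [expo_apply, ← zpow_natCast, Int.toNat_of_nonneg (T.mulVec_nonneg (mem_supportIn.1 ha).1 k)]
  refine (Finset.prod_congr rfl fun k _ => h1 k).trans ?_
  simp only [w, laurent, Finset.sum_apply, Pi.smul_apply, smul_eq_mul, zpow_sum (hx _)]
  simp_rw [← Finset.prod_zpow, ← zpow_mul]
  rw [Finset.prod_comm]
  simp_rw [mul_comm]

end ChainTransformation

end Evaluation

/-! ### The one-parameter degeneration of the restricted system -/

section Degeneration

variable {K : Type*} [RCLike K] {n : ℕ} {f : Fin n → MvPolynomial (Fin n) K}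

namespace ChainTransformation

variable (T : ChainTransformation f) (A : Fin n → ℤ)

/-- The monomial `x ^ (a - vᵢ)` along `x_l = w ^ (U e_l) s ^ (A_l)`, as a function of `(w, s)`. For
`a` in the support of `f i` and a weight `A` of a tuple of the flag, no exponent is truncated. -/
noncomputable def curveMonomial (i : Fin n) (a : Fin n →₀ ℕ) (q : (Fin n → K) × K) : K :=
  (∏ k, q.1 k ^ T.expo i a k) * q.2 ^ (A ⬝ᵥ (intVec a - T.vertex i)).toNat

/-- The polynomial `x ^ (-vᵢ) f_{i,γ'}(x)` along `x_l = w ^ (U e_l) s ^ (A_l)`. -/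
noncomputable def curvePoly (γ' : Fin n → Set (Fin n → ℝ)) (i : Fin n) (q : (Fin n → K) × K) : K :=
  ∑ a ∈ supportIn (f i) (γ' i), (f i).coeff a * T.curveMonomial A i a q

theorem contDiff_curveMonomial (i : Fin n) (a : Fin n →₀ ℕ) :
    ContDiff K 1 (T.curveMonomial A i a) := by
  unfold curveMonomial
  refine ContDiff.mul (contDiff_prod fun k _ => ?_) (contDiff_snd.pow _)
  exact ((contDiff_apply K K k).comp contDiff_fst).pow _

theorem contDiff_curvePoly (γ' : Fin n → Set (Fin n → ℝ)) (i : Fin n) :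
    ContDiff K 1 (T.curvePoly A γ' i) := by
  unfold curvePoly
  exact ContDiff.sum fun a _ => contDiff_const.mul (T.contDiff_curveMonomial A i a)

variable {T A} {γ γ' : Fin n → Set (Fin n → ℝ)} {j : Fin (n + 1)}

theorem curveMonomial_zero_of_notMem (hA : IsWeight f γ A) (hj : T.flag j = γ) {i : Fin n}
    {a : Fin n →₀ ℕ} (ha : a ∈ (f i).support) (ha' : realVec (intVec a) ∉ γ i) (w : Fin n → K) :
    T.curveMonomial A i a (w, 0) = 0 := by
  have h0 := weight_nonneg hA hj ha
  have h1 := mt (weight_eq_zero_iff hA hj ha).1 ha'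
  rw [curveMonomial, zero_pow (by omega), mul_zero]

/-- At `s = 0` only the part of the polynomial on the smaller face remains. -/
theorem curvePoly_zero (hA : IsWeight f γ A) (hj : T.flag j = γ) (hle : IsSubTuple γ γ')
    (i : Fin n) (w : Fin n → K) : T.curvePoly A γ' i (w, 0) = eval w (T.F γ i) := by
  simp only [curvePoly, F_eq, map_sum, eval_monomial_eq_prod]
  rw [← Finset.sum_subset (s₁ := supportIn (f i) (γ i)) (fun a ha => ?_) fun a ha ha' => ?_]
  · refine Finset.sum_congr rfl fun a ha => ?_
    obtain ⟨h1, h2⟩ := mem_supportIn.1 ha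
    rw [curveMonomial, (weight_eq_zero_iff hA hj h1).2 h2, Int.toNat_zero, pow_zero, mul_one]
  · obtain ⟨h1, h2⟩ := mem_supportIn.1 ha
    exact mem_supportIn.2 ⟨h1, hle i h2⟩
  · have h1 := (mem_supportIn.1 ha).1
    rw [curveMonomial_zero_of_notMem hA hj h1 (fun h2 => ha' (mem_supportIn.2 ⟨h1, h2⟩)), mul_zero]

theorem curveMonomial_eq_laurent (hA : IsWeight f γ A) (hj : T.flag j = γ) {i : Fin n}
    {a : Fin n →₀ ℕ} (ha : a ∈ (f i).support) {q : (Fin n → K) × K} (hw : ∀ k, q.1 k ≠ 0)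
    (hs : q.2 ≠ 0) : T.curveMonomial A i a q =
      laurent (fun l => laurent q.1 (fun k => T.U k l) * q.2 ^ A l) (intVec a - T.vertex i) := by
  rw [laurent_monomialCurve hw hs, curveMonomial,
    laurent_eq_prod_toNat q.1 (T.mulVec_nonneg ha), ← zpow_natCast q.2,
    Int.toNat_of_nonneg (weight_nonneg hA hj ha)]
  rfl

/-- Under genericity at `γ`, the `F i` with `i ∉ θ(γ)` are submersive at every point with the first
coordinates of a common zero `z` on the stratum, as soon as they are at most `m` in number. -/
theorem exists_hasDerivAt_F (hγ : IsMinimized f γ) (hj : T.flag j = γ)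
    (hgen : 1 ≤ (j : ℕ) → IsGenericAt f γ) (hT : T.IsFor γ)
    {I : Finset (Fin n)} (hI : I.card ≤ j) {z w : Fin n → K} (hz : z ∈ torusStratum K n j)
    (hw : ∀ k : Fin n, (k : ℕ) < j → w k = z k) (hzF : ∀ i ∈ I, eval z (T.F γ i) = 0)
    (u : I → K) :
    ∃ v : Fin n → K, ∀ i : I, HasDerivAt (fun t : K => eval (w + t • v) (T.F γ i)) (u i) 0 := by
  classical
  rcases Nat.eq_zero_or_pos (j : ℕ) with h0 | h0
  · have : I = ∅ := Finset.card_eq_zero.1 (by omega)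
    subst this
    exact ⟨0, fun i => absurd i.2 (Finset.notMem_empty _)⟩
  have hdim := T.tupleDim_flag hj
  have hrank := hgen h0 T hT I z (hdim ▸ hz)
    fun i hi => (eval_g_eq_eval_F hγ hj hz i).trans (hzF i hi)
  rw [hdim, min_eq_left hI] at hrank
  obtain ⟨v, hv⟩ := mulVec_surjective_of_rank_eq _ (hrank.trans (Fintype.card_coe I).symm) u
  refine ⟨fun k => if hk : (k : ℕ) < j then v ⟨k, hk⟩ else 0, fun i => ?_⟩
  convert hasDerivAt_eval_add_smul (T.F γ i) w _ using 1
  rw [← hv]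
  simp only [Matrix.mulVec, dotProduct, jacobian, Matrix.of_apply]
  rw [← Finset.sum_subset (Finset.filter_subset (fun k : Fin n => (k : ℕ) < j) Finset.univ)
      (fun k _ hk => by rw [dif_neg (by simpa using hk), zero_mul]),
    Finset.sum_subtype _ (p := fun k : Fin n => (k : ℕ) < j) (by simp)]
  refine Finset.sum_congr rfl fun k _ => ?_
  rw [dif_pos k.2, eval_pderiv_g_eq hγ hj hz hw i k.2, mul_comm]

end ChainTransformation

end Degeneration

end TBG

/-! ### The closure property of the sets `X_γ(f)` -/

open TBG TBG.ChainTransformation MvPolynomial Filter Topology in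
theorem mainTheorem6 {K : Type*} [RCLike K] {n : ℕ} (f : Fin n → MvPolynomial (Fin n) K)
    (hf0 : ∀ i, MvPolynomial.eval 0 (f i) ≠ 0) (hf : TBG.IsVeryTBG f)
    (m : ℕ) (hm : m + 2 ≤ n)
    (γ γ' : Fin n → Set (Fin n → ℝ))
    (hγ : TBG.IsMinimized f γ) (hγs : TBG.IsSemiOrigin γ) (hγm : TBG.tupleDim γ = m)
    (hγ' : TBG.IsMinimized f γ') (hγ'm : TBG.tupleDim γ' = m + 1)
    (hle : TBG.IsSubTuple γ γ')
    (T T' : TBG.ChainTransformation f) (hT : T.IsFor γ) (hT' : T'.IsFor γ') :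
    T.X γ = ∅ ∨ T.X γ ⊆ closure (T'.X γ') := by
  classical
  by_cases hcard : tupleDim γ + 1 ≤ (originSet γ)ᶜ.ncard
  · exact Or.inl (hf.2 γ hγ hγs hcard T hT)
  refine Or.inr ?_
  rintro y ⟨z, ⟨hz, hzF⟩, hy⟩
  obtain ⟨j, hj⟩ := hT.1
  obtain ⟨j', hj'⟩ := hT'.1
  have hdim := T.tupleDim_flag hj
  have hdim' := T'.tupleDim_flag hj'
  obtain ⟨A, hA⟩ := hγ.exists_isWeight
  have hsub : ∀ i, i ∈ originSet γ → i ∈ originSet γ' := fun i hi =>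
    (hγ'.isOriginFace_iff i).2 (hle i ((hγ.isOriginFace_iff i).1 hi))
  have hsupp : ∀ i, (0 : Fin n →₀ ℕ) ∈ (f i).support := by
    intro i
    have := hf0 i
    rwa [eval_zero, constantCoeff_eq, ← mem_support_iff] at this
  have hint0 : intVec (0 : Fin n →₀ ℕ) = 0 := rfl
  have hreal0 : realVec (0 : Fin n → ℤ) = 0 := by ext; simp [realVec]
  let I : Finset (Fin n) := Finset.univ.filter (· ∉ originSet γ)
  have hmemI : ∀ i, i ∈ I ↔ i ∉ originSet γ := fun i => by simp [I]
  have hIcard : I.card ≤ j := by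
    have : (originSet γ)ᶜ = (I : Set (Fin n)) := by ext i; simp [hmemI]
    rw [this, Set.ncard_coe_finset, hdim] at hcard
    omega
  rw [hdim] at hz
  -- Any nonzero values may be given to the coordinates on which the `F i` do not depend.
  let w₀ : Fin n → K := fun k => if (k : ℕ) < j then z k else 1
  have hw₀ : ∀ k : Fin n, (k : ℕ) < j → w₀ k = z k := fun k hk => if_pos hk
  have hw₀' : ∀ k, w₀ k ≠ 0 := by
    intro k
    by_cases hk : (k : ℕ) < j
    · rw [hw₀ k hk]; exact (hz k).2 hk
    · simp [w₀, hk]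
  let η : Fin n → K := fun i => if i ∈ originSet γ' then y i else 0
  let H : (Fin n → K) × K → I → K := fun q i =>
    T.curvePoly A γ' i q - η i * T.curveMonomial A i 0 q
  have hH0 : ∀ w, ∀ i : I, H (w, 0) i = eval w (T.F γ i) := by
    intro w i
    have h0 : realVec (intVec (0 : Fin n →₀ ℕ)) ∉ γ i := fun h =>
      (hmemI i).1 i.2 ((hγ.isOriginFace_iff i).2 (by rwa [hint0, hreal0] at h))
    simp only [H]
    rw [curvePoly_zero hA hj hle, curveMonomial_zero_of_notMem hA hj (hsupp i) h0, mul_zero,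
      sub_zero]
  have hHdiff : ContDiff K 1 H := contDiff_pi.2 fun i =>
    (T.contDiff_curvePoly A γ' i).sub (contDiff_const.mul (T.contDiff_curveMonomial A i 0))
  have hzF' : ∀ i ∈ I, eval z (T.F γ i) = 0 := fun i hi => hzF i ((hmemI i).1 hi)
  have hzeros : ∃ᶠ q in 𝓝 (w₀, (0 : K)), H q = 0 ∧ q.2 ≠ 0 := by
    refine frequently_zero_of_surjective H w₀ hHdiff.contDiffAt ?_ fun u => ?_
    · funext i
      rw [hH0, ← eval_F_stratum hj hw₀]
      exact hzF' i i.2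
    · obtain ⟨v, hv⟩ := exists_hasDerivAt_F hγ hj
        (fun h1 => hf.1.2 γ hγ (hdim ▸ h1) (by omega)) hT hIcard hz hw₀ hzF' u
      exact ⟨v, hasDerivAt_pi.2 fun i => by simpa only [hH0] using hv i⟩
  -- The approximating points: the coordinates outside `θ(γ)` are kept.
  let Y : (Fin n → K) × K → Fin n → K := fun q i =>
    if i ∈ originSet γ then T.curvePoly A γ' i q else y i
  have hY : Tendsto Y (𝓝 (w₀, 0)) (𝓝 y) := by
    refine tendsto_pi_nhds.2 fun i => ?_
    by_cases hi : i ∈ originSet γ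
    · have hval : T.curvePoly A γ' i (w₀, 0) = y i := by
        rw [curvePoly_zero hA hj hle, ← eval_F_stratum hj hw₀, hy i hi]
      simpa only [Y, hi, if_true, hval] using (T.contDiff_curvePoly A γ' i).continuous.tendsto (w₀, 0)
    · simpa only [Y, hi, if_false] using tendsto_const_nhds
  have hne : ∀ᶠ q in 𝓝 (w₀, (0 : K)), ∀ k, q.1 k ≠ 0 := by
    refine eventually_all.2 fun k => ?_
    have hc : Continuous fun q : (Fin n → K) × K => q.1 k := (continuous_apply k).comp continuous_fst
    exact hc.continuousAt.eventually_ne (hw₀' k)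
  refine mem_closure_of_frequently_of_tendsto ((hzeros.and_eventually hne).mono ?_) hY
  rintro q ⟨⟨hq0, hs⟩, hw⟩
  let x : Fin n → K := fun l => laurent q.1 (fun k => T.U k l) * q.2 ^ A l
  have hx : ∀ l, x l ≠ 0 := fun l => mul_ne_zero (laurent_ne_zero hw _) (zpow_ne_zero _ hs)
  obtain ⟨z', hz', hF⟩ := exists_stratum_eval_F (T := T') hj' hx
  -- Passing from the vertices of one chain transformation to those of the other multiplies by a unit.
  have hF' : ∀ i, eval z' (T'.F γ' i) =
      laurent x (T.vertex i - T'.vertex i) * T.curvePoly A γ' i q := by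
    intro i
    rw [hF, curvePoly, Finset.mul_sum]
    refine Finset.sum_congr rfl fun a ha => ?_
    rw [curveMonomial_eq_laurent hA hj (mem_supportIn.1 ha).1 hw hs, mul_left_comm,
      ← laurent_add hx]
    congr 2
    abel
  have hcurve : ∀ i, i ∉ originSet γ →
      T.curvePoly A γ' i q = η i * T.curveMonomial A i 0 q := fun i hi =>
    sub_eq_zero.1 (congrFun hq0 ⟨i, (hmemI i).2 hi⟩)
  refine ⟨z', ⟨by rwa [hdim'], fun i hi => ?_⟩, fun i hi => ?_⟩
  · rw [hF', hcurve i (fun h => hi (hsub i h))]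
    simp [η, hi]
  · rw [hF', (hT'.2 i).2 hi]
    by_cases hi' : i ∈ originSet γ
    · rw [(hT.2 i).2 hi', sub_zero, laurent_zero, one_mul]
      simp [Y, hi']
    · rw [hcurve i hi', curveMonomial_eq_laurent hA hj (hsupp i) hw hs, mul_left_comm,
        ← laurent_add hx, hint0]
      simp [Y, hi', η, hi, laurent_zero]
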